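/- Let $\Gamma$ be a countably infinite discrete group acting continuously on a compact metrizable space $X$. Let $\mathcal M(X)$ be the space of Borel probability measures on $X$ with the weak$^*$-topology, on which $\Gamma$ acts continuously by push-forward, and for each positive integer $N$ let $\mathcal M_N(X)\subseteq \mathcal M(X)$ be the closed $\Gamma$-invariant subset of those $\mu$ whose support has at most $N$ points. For a continuous action of $\Gamma$ on a compact metrizable space $Y$, an integer $k\ge 1$ and subsets $A_1,\dots,A_k$ of $Y$, a set $F\subseteq\Gamma$ is called an independence set for $(A_1,\dots,A_k)$ if $\bigcap_{s\in J}s^{-1}A_{\sigma(s)}\neq\emptyset$ for every nonempty finite set $J\subseteq F$ and every map $\sigma\colon J\to\{1,\dots,k\}$. A tuple $(y_1,\dots,y_k)\in Y^k$ is called an IT-tuple if for every product neighborhood $U_1\times\cdots\times U_k$ of it in $Y^k$, the tuple $(U_1,\dots,U_k)$ has an infinite independence set. Denote by $\mathrm{IT}_k(Y)$ the set of IT-tuples of length $k$ in $Y$. Then for any positive integers $k, N_1,\dots,N_k$, setting $N=\prod_{j=1}^k N_j$, one has $$\bigl(\mathcal M_{N_1}(X)\times\cdots\times\mathcal M_{N_k}(X)\bigr)\cap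 \mathrm{IT}_k(\mathcal M(X))\subseteq \mathrm{IT}_k(\mathcal M_N(X)),$$ where $\mathrm{IT}_k(\mathcal M_N(X))$ is formed with respect to the restricted action of $\Gamma$ on $\mathcal M_N(X)$ and is regarded as a subset of $\mathcal M(X)^k$. -/

import Mathlib

open MeasureTheory Topology

noncomputable section

/-- `F ⊆ Γ` is an independence set for the tuple `A = (A₁, …, A_k)` of subsets of `Y`:
`⋂_{s ∈ J} s⁻¹ A_{σ(s)} ≠ ∅` for every nonempty finite `J ⊆ F` and every map `σ : J → [k]`.
Here `s⁻¹ A = {y | s y ∈ A}`. -/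
def IsIndependenceSet {Γ Y : Type*} [SMul Γ Y] {k : ℕ} (A : Fin k → Set Y) (F : Set Γ) : Prop :=
  ∀ J : Finset Γ, J.Nonempty → (J : Set Γ) ⊆ F → ∀ σ : J → Fin k,
    (⋂ s : J, (fun y : Y => (s : Γ) • y) ⁻¹' A (σ s)).Nonempty

/-- The set `IT_k(Y)` of IT-tuples of length `k` of an action of `Γ` on `Y`: those `x ∈ Y^k` such
that for every product neighborhood `U₁ × ⋯ × U_k` of `x`, the tuple `(U₁, …, U_k)` has an
infinite independence set. -/
def ITTuples (Γ Y : Type*) [SMul Γ Y] [TopologicalSpace Y] (k : ℕ) : Set (Fin k → Y) :=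
  {x | ∀ U : Fin k → Set Y, (∀ j, U j ∈ 𝓝 (x j)) →
    ∃ F : Set Γ, F.Infinite ∧ IsIndependenceSet U F}

section Action

variable {Γ X : Type*} [Group Γ] [MulAction Γ X] [TopologicalSpace X] [ContinuousConstSMul Γ X]
  [MeasurableSpace X] [BorelSpace X]

/-- The induced action of `Γ` on the Borel probability measures of `X`, by push-forward. Together
with Mathlib's topology of weak convergence on `ProbabilityMeasure X` (for compact `X` the
weak-* topology) this is the action of `Γ` on `M(X)`. -/
instance probabilityMeasureMulAction : MulAction Γ (ProbabilityMeasure X) where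
  smul g μ := μ.map (measurable_const_smul g).aemeasurable
  one_smul μ := by
    apply Subtype.ext
    change Measure.map (fun x : X => (1 : Γ) • x) (μ : Measure X) = (μ : Measure X)
    simp
  mul_smul g h μ := by
    apply Subtype.ext
    change Measure.map (fun x : X => (g * h) • x) (μ : Measure X) =
      Measure.map (fun x : X => g • x) (Measure.map (fun x : X => h • x) (μ : Measure X))
    rw [Measure.map_map (measurable_const_smul g) (measurable_const_smul h)]
    congr 1
    funext x
    exact mul_smul g h x

theorem coe_smul_probabilityMeasure (g : Γ) (μ : ProbabilityMeasure X) :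
    ((g • μ : ProbabilityMeasure X) : Measure X) =
      Measure.map (fun x : X => g • x) (μ : Measure X) := rfl

/-- `M_N(X)`: the Borel probability measures on `X` whose support has at most `N` points. -/
def finSuppMeasures (X : Type*) [TopologicalSpace X] [MeasurableSpace X] (N : ℕ) :
    Set (ProbabilityMeasure X) :=
  {μ | (μ : Measure X).support.encard ≤ N}

/-- `M_N(X)` is invariant under the action of `Γ`. -/
theorem smul_mem_finSuppMeasures (N : ℕ) (g : Γ) {μ : ProbabilityMeasure X}
    (hμ : μ ∈ finSuppMeasures X N) : g • μ ∈ finSuppMeasures X N := by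
  have key : ((g • μ : ProbabilityMeasure X) : Measure X).support ⊆
      (fun x : X => g • x) '' (μ : Measure X).support := by
    intro x hx
    refine ⟨g⁻¹ • x, ?_, smul_inv_smul g x⟩
    rw [Measure.mem_support_iff_forall] at hx ⊢
    intro U hU
    obtain ⟨V, hVU, hV, hxV⟩ := mem_nhds_iff.1 hU
    have hW : IsOpen ((fun y : X => g⁻¹ • y) ⁻¹' V) := hV.preimage (continuous_const_smul g⁻¹)
    have h := hx _ (hW.mem_nhds hxV)
    rw [coe_smul_probabilityMeasure,
      Measure.map_apply (measurable_const_smul g) hW.measurableSet] at h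
    refine h.trans_le (measure_mono ?_)
    intro y hy
    apply hVU
    simpa using hy
  exact ((Set.encard_le_encard key).trans (Set.encard_image_le _ _)).trans hμ

/-- The restriction of the action of `Γ` on `M(X)` to the invariant set `M_N(X)`. -/
instance finSuppMeasuresMulAction (N : ℕ) : MulAction Γ (finSuppMeasures X N) where
  smul g μ := ⟨g • (μ : ProbabilityMeasure X), smul_mem_finSuppMeasures N g μ.2⟩
  one_smul μ := Subtype.ext (one_smul Γ (μ : ProbabilityMeasure X))
  mul_smul g h μ := Subtype.ext (mul_smul g h (μ : ProbabilityMeasure X))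

end Action

end

/-! Let `μ j` have finite support `S j`. Bump functions `φ j l` around the atoms `l` turn nearness
to `μ j` into lower bounds `c j l` on integrals. An infinite independence set `F` of measures then
provides, for every finite pattern `σ`, a measure `ν` with `c (σ s) l ≤ ∫ φ (σ s) l (s • x) ∂ν` for
all `s` in the pattern. The new measures must have at most `∏ N j` atoms, so one atom is assigned to
each `i` in the product of the `S j`, and the orbit of that atom should visit the neighborhood of `i
(σ s)` at time `s`.

The weights come from randomizing the pattern. `exists_joint_measure` gives a law `P` of pairs `(σ,
x)` with `σ` uniform and the bounds valid on average. Along a nonprincipal ultrafilter in `s`, the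
functions `1_{σ s = j} φ j l (s • x)` have weak limits `f j l`. Pairwise independence forces the
weak limit of `1_{σ s = j}` to be the constant `1/k`, so `g j l = k f j l` satisfies `∑ l, g j l ≤
1` almost everywhere and `c j l ≤ ∫ g j l`. Choosing the coordinates of `i` independently at each
point, with probabilities `g j l`, yields weights `w i = ∫ ∏ j, g j (i j)` whose marginals are
almost the `c j l`.

If `w i > 0`, all `f j (i j)` are positive together on a set of positive measure. Elements `s` can
then be picked one by one so that every pattern keeps positive integral, for all such `i`
simultaneously (`exists_infinite_forall_integral_prod_pos`). On the resulting infinite set each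
pattern is realized by a point for each such `i`, and these points weighted by `w` form the required
measure. -/

/-! ### Weak limits of bounded functions -/

open Filter in
/-- Measurable functions with values in `[0, 1]` have a weak limit along every ultrafilter. -/
theorem exists_weak_limit_of_mem_Icc {Z ι : Type*} [MeasurableSpace Z] (P : Measure Z)
    [IsProbabilityMeasure P] (U : Ultrafilter ι) (g : ι → Z → ℝ) (hg : ∀ s, Measurable (g s))
    (h01 : ∀ s z, g s z ∈ Set.Icc (0 : ℝ) 1) :
    ∃ f : Z → ℝ, Measurable f ∧ (∀ z, f z ∈ Set.Icc (0 : ℝ) 1) ∧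
      ∀ (h : Z → ℝ) (C : ℝ), Measurable h → (∀ z, |h z| ≤ C) →
        Tendsto (fun s => ∫ z, h z * g s z ∂P) U (𝓝 (∫ z, h z * f z ∂P)) := by
  have bdd : ∀ (h : Z → ℝ) (C : ℝ), Measurable h → (∀ z, |h z| ≤ C) → MemLp h 2 P :=
    fun h C hm hC => MemLp.of_bound hm.aestronglyMeasurable C (.of_forall hC)
  have hg1 : ∀ s z, |g s z| ≤ 1 := fun s z => abs_le.2 ⟨by linarith [(h01 s z).1], (h01 s z).2⟩
  have hgL : ∀ s, MemLp (g s) 2 P := fun s => bdd _ 1 (hg s) (hg1 s)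
  let G : ι → Lp ℝ 2 P := fun s => (hgL s).toLp
  have hG : ∀ s, ‖G s‖ ≤ 1 := by
    intro s
    have := Lp.norm_le_of_ae_bound (f := G s) (C := 1) zero_le_one (by
      filter_upwards [(hgL s).coeFn_toLp] with z hz
      change ‖((hgL s).toLp) z‖ ≤ 1
      rw [hz]; exact hg1 s z)
    simpa [measureUnivNNReal] using this
  let D : ι → WeakDual ℝ (Lp ℝ 2 P) := fun s =>
    StrongDual.toWeakDual (InnerProductSpace.toDual ℝ (Lp ℝ 2 P) (G s))
  -- Banach–Alaoglu in the dual of `L²`; the Riesz isomorphism then represents the limit functional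
  -- by a function.
  obtain ⟨d, -, hd⟩ := (WeakDual.isCompact_closedBall (0 : StrongDual ℝ (Lp ℝ 2 P))
    1).ultrafilter_le_nhds (U.map D) (by
      rw [Ultrafilter.coe_map, le_principal_iff, Filter.mem_map]
      refine univ_mem' fun s => ?_
      change InnerProductSpace.toDual ℝ (Lp ℝ 2 P) (G s) ∈ Metric.closedBall _ _
      simpa using hG s)
  have hd' : Tendsto D U (𝓝 d) := hd
  let f₀ : Lp ℝ 2 P := (InnerProductSpace.toDual ℝ (Lp ℝ 2 P)).symm (WeakDual.toStrongDual d)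
  have key : ∀ h : Z → ℝ, MemLp h 2 P →
      Tendsto (fun s => ∫ z, h z * g s z ∂P) U (𝓝 (∫ z, h z * f₀ z ∂P)) := by
    intro h hh
    have h1 : Tendsto (fun s => D s hh.toLp) U (𝓝 (d hh.toLp)) :=
      ((WeakDual.eval_continuous hh.toLp).tendsto d).comp hd'
    have h2 : ∀ s, D s hh.toLp = ∫ z, h z * g s z ∂P := by
      intro s
      change inner ℝ (G s) hh.toLp = _
      rw [L2.inner_def]
      refine integral_congr_ae ?_
      filter_upwards [(hgL s).coeFn_toLp, hh.coeFn_toLp] with z hz hz'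
      change inner ℝ ((hgL s).toLp (g s) z) _ = _
      rw [hz, hz']; simp
    have h3 : d hh.toLp = ∫ z, h z * f₀ z ∂P := by
      have : d hh.toLp = inner ℝ f₀ hh.toLp := by
        rw [← InnerProductSpace.toDual_apply_apply (𝕜 := ℝ), LinearIsometryEquiv.apply_symm_apply]
        rfl
      rw [this, L2.inner_def]
      refine integral_congr_ae ?_
      filter_upwards [hh.coeFn_toLp] with z hz'
      rw [hz']; simp
    rw [← h3]; exact h1.congr h2
  have hf₀ : MemLp f₀ 2 P := Lp.memLp f₀
  have hf₀i : Integrable f₀ P := hf₀.integrable one_le_two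
  have hset : ∀ E, MeasurableSet E →
      Tendsto (fun s => ∫ z in E, g s z ∂P) U (𝓝 (∫ z in E, f₀ z ∂P)) := by
    intro E hE
    have := key (E.indicator 1) (bdd _ 1 (measurable_one.indicator hE) fun z => by
      by_cases hz : z ∈ E <;> simp [hz])
    have e : ∀ q : Z → ℝ, ∫ z, E.indicator 1 z * q z ∂P = ∫ z in E, q z ∂P := by
      intro q
      rw [← integral_indicator hE]
      congr 1; ext z
      by_cases hz : z ∈ E <;> simp [hz]
    simpa only [e] using this
  have hgi : ∀ s, Integrable (g s) P := fun s => (hgL s).integrable one_le_two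
  have h0 : 0 ≤ᵐ[P] f₀ := by
    refine ae_nonneg_of_forall_setIntegral_nonneg hf₀i fun E hE _ => ?_
    exact ge_of_tendsto' (hset E hE) fun s => integral_nonneg fun z => (h01 s z).1
  have h1 : f₀ ≤ᵐ[P] fun _ => (1 : ℝ) := by
    refine ae_le_of_forall_setIntegral_le hf₀i (integrable_const 1) fun E hE _ => ?_
    exact le_of_tendsto' (hset E hE) fun s =>
      integral_mono (hgi s).integrableOn (integrable_const 1) fun z => (h01 s z).2
  have hm := hf₀.1.aemeasurable
  -- Clamping a measurable representative changes it only on a null set and gives the bounds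
  -- everywhere.
  refine ⟨fun z => max 0 (min 1 (hm.mk _ z)), by have := hm.measurable_mk; fun_prop,
    fun z => ⟨le_max_left _ _, max_le zero_le_one (min_le_left _ _)⟩, fun h C hh hC => ?_⟩
  have : ∫ z, h z * max 0 (min 1 (hm.mk _ z)) ∂P = ∫ z, h z * f₀ z ∂P := by
    refine integral_congr_ae ?_
    filter_upwards [h0, h1, hm.ae_eq_mk] with z hz0 hz1 hz
    rw [← hz, min_eq_right hz1, max_eq_right (show (0 : ℝ) ≤ f₀ z from hz0)]
  rw [this]
  exact key h (bdd h C hh hC)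

/-! ### Coupling of sub-probability vectors -/

theorem one_sub_sum_le_prod_one_sub {α : Type*} (s : Finset α) (u : α → ℝ)
    (h0 : ∀ x, 0 ≤ u x) (h1 : ∀ x, u x ≤ 1) : 1 - ∑ x ∈ s, u x ≤ ∏ x ∈ s, (1 - u x) := by
  classical
  induction s using Finset.induction_on with
  | empty => simp
  | insert a s ha ih =>
    rw [Finset.sum_insert ha, Finset.prod_insert ha]
    nlinarith [h0 a, mul_le_mul_of_nonneg_left ih (sub_nonneg.2 (h1 a)),
      mul_nonneg (h0 a) (Finset.sum_nonneg fun x (_ : x ∈ s) => h0 x)]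

/-- The restricted sum factors as `a j l` times the total masses of the other coordinates. Each such
mass is one minus its deficit, so the product is at least one minus the sum of the deficits; since
`a j l ≤ 1`, the loss is at most the total deficit. -/
theorem sub_sum_one_sub_sum_le_sum_prod {K : Type*} [Fintype K] [DecidableEq K]
    {L : K → Type*} [∀ j, Fintype (L j)] [∀ j, DecidableEq (L j)] (a : ∀ j, L j → ℝ)
    (h0 : ∀ j l, 0 ≤ a j l) (hs : ∀ j, ∑ l, a j l ≤ 1) (h1 : ∀ j l, a j l ≤ 1)
    (j : K) (l : L j) :
    a j l - ∑ j', (1 - ∑ l', a j' l') ≤ ∑ i : ∀ j, L j with i j = l, ∏ j, a j (i j) := by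
  have e : (Finset.univ.filter fun i : ∀ j, L j => i j = l) =
      Fintype.piFinset (Function.update (fun j => (Finset.univ : Finset (L j))) j {l}) := by
    ext i
    simp only [Finset.mem_filter, Finset.mem_univ, true_and, Fintype.mem_piFinset]
    constructor
    · rintro rfl j'
      by_cases h : j' = j
      · subst h; simp
      · simp [h]
    · intro h
      simpa using h j
  rw [e, ← Finset.prod_univ_sum, ← Finset.mul_prod_erase _ _ (Finset.mem_univ j)]
  simp only [Function.update_self, Finset.sum_singleton]
  have e2 : ∏ x ∈ Finset.univ.erase j, ∑ y ∈ Function.update (fun j =>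
      (Finset.univ : Finset (L j))) j {l} x, a x y =
      ∏ x ∈ Finset.univ.erase j, (1 - (1 - ∑ y, a x y)) := by
    refine Finset.prod_congr rfl fun x hx => ?_
    rw [Function.update_of_ne (Finset.ne_of_mem_erase hx)]; ring
  rw [e2]
  have h2 : 1 - ∑ x ∈ Finset.univ.erase j, (1 - ∑ y, a x y) ≤
      ∏ x ∈ Finset.univ.erase j, (1 - (1 - ∑ y, a x y)) :=
    one_sub_sum_le_prod_one_sub _ _
      (fun x => by linarith [hs x])
      (fun x => by linarith [Finset.sum_nonneg fun l (_ : l ∈ Finset.univ) => h0 x l])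
  have h3 : ∑ x ∈ Finset.univ.erase j, (1 - ∑ y, a x y) ≤ ∑ j', (1 - ∑ l', a j' l') :=
    Finset.sum_le_sum_of_subset_of_nonneg (Finset.erase_subset _ _)
      fun x _ _ => by linarith [hs x]
  have h4 : 0 ≤ ∑ x ∈ Finset.univ.erase j, (1 - ∑ y, a x y) :=
    Finset.sum_nonneg fun x _ => by linarith [hs x]
  nlinarith [h0 j l, h1 j l, mul_le_mul_of_nonneg_left h2 (h0 j l),
    mul_nonneg h4 (sub_nonneg.2 (h1 j l))]

/-- Coupling: `[0, 1]`-valued functions `g j l` with `∑ l, g j l ≤ 1` almost everywhere yield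
weights on `∀ j, L j` whose marginals are nearly the integrals of the `g j l`. -/
theorem coupling_weights {Z K : Type*} [MeasurableSpace Z] [Fintype K] [DecidableEq K]
    {L : K → Type*} [∀ j, Fintype (L j)] [∀ j, DecidableEq (L j)] (P : Measure Z)
    [IsProbabilityMeasure P] (g : ∀ j, L j → Z → ℝ) (hg : ∀ j l, Measurable (g j l))
    (h0 : ∀ j l z, 0 ≤ g j l z) (hs : ∀ j, ∀ᵐ z ∂P, ∑ l, g j l z ≤ 1)
    (c : ∀ j, L j → ℝ) (hc : ∀ j l, c j l ≤ ∫ z, g j l z ∂P) :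
    ∑ i : ∀ j, L j, ∫ z, ∏ j, g j (i j) z ∂P ≤ 1 ∧
    ∀ j l, c j l - ∑ j', (1 - ∑ l', c j' l') ≤
      ∑ i : ∀ j, L j with i j = l, ∫ z, ∏ j, g j (i j) z ∂P := by
  have hs' : ∀ᵐ z ∂P, ∀ j, ∑ l, g j l z ≤ 1 := ae_all_iff.2 hs
  have hle : ∀ᵐ z ∂P, ∀ j l, g j l z ≤ 1 := by
    filter_upwards [hs'] with z hz j l
    exact (Finset.single_le_sum (f := fun l => g j l z) (fun l _ => h0 j l z)
      (Finset.mem_univ l)).trans (hz j)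
  have hi : ∀ j l, Integrable (g j l) P := fun j l =>
    Integrable.of_bound (hg j l).aestronglyMeasurable 1 (by
      filter_upwards [hle] with z hz
      rw [Real.norm_of_nonneg (h0 j l z)]; exact hz j l)
  have hpi : ∀ i : ∀ j, L j, Integrable (fun z => ∏ j, g j (i j) z) P := fun i =>
    Integrable.of_bound (by fun_prop) 1 (by
      filter_upwards [hle] with z hz
      rw [Real.norm_of_nonneg (Finset.prod_nonneg fun j _ => h0 j _ z)]
      exact Finset.prod_le_one (fun j _ => h0 j _ z) fun j _ => hz j _)
  constructor
  · rw [← integral_finsetSum _ fun i _ => hpi i]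
    calc ∫ z, ∑ i : ∀ j, L j, ∏ j, g j (i j) z ∂P ≤ ∫ z, (1 : ℝ) ∂P := by
          refine integral_mono_ae (integrable_finsetSum _ fun i _ => hpi i)
            (integrable_const 1) ?_
          filter_upwards [hs'] with z hz
          rw [← Fintype.prod_sum (fun j l => g j l z)]
          exact Finset.prod_le_one (fun j _ => Finset.sum_nonneg fun l _ => h0 j l z)
            fun j _ => hz j
      _ = 1 := by simp
  · intro j l
    rw [← integral_finsetSum _ fun i _ => hpi i]
    have hsi : ∀ j', Integrable (fun z => 1 - ∑ l', g j' l' z) P := fun j' =>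
      (integrable_const 1).sub (integrable_finsetSum _ fun l' _ => hi j' l')
    calc c j l - ∑ j', (1 - ∑ l', c j' l')
        ≤ ∫ z, g j l z ∂P - ∑ j', ∫ z, (1 - ∑ l', g j' l' z) ∂P := by
          refine sub_le_sub (hc j l) (Finset.sum_le_sum fun j' _ => ?_)
          rw [integral_sub (integrable_const 1) (integrable_finsetSum _ fun l' _ => hi j' l'),
            integral_finsetSum _ fun l' _ => hi j' l']
          have := Finset.sum_le_sum fun l' (_ : l' ∈ Finset.univ) => hc j' l'
          simpa only [integral_const, probReal_univ, one_smul] using sub_le_sub_left this 1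
      _ = ∫ z, (g j l z - ∑ j', (1 - ∑ l', g j' l' z)) ∂P := by
          rw [integral_sub (hi j l) (integrable_finsetSum _ fun j' _ => hsi j'),
            integral_finsetSum _ fun j' _ => hsi j']
      _ ≤ _ := by
          refine integral_mono_ae ((hi j l).sub (integrable_finsetSum _ fun j' _ => hsi j'))
            (integrable_finsetSum _ fun i _ => hpi i) ?_
          filter_upwards [hs', hle] with z hz hz1
          exact sub_sum_one_sub_sum_le_sum_prod (fun j l => g j l z) (fun j l => h0 j l z) hz
            (fun j l => hz1 j l) j l

/-! ### Randomizing the pattern -/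

/-- The sequence `ι → Fin k` of independent uniform variables. -/
noncomputable def uniformProduct (ι : Type*) (k : ℕ) [NeZero k] : Measure (ι → Fin k) :=
  Measure.infinitePi fun _ => (PMF.uniformOfFintype (Fin k)).toMeasure

instance (ι : Type*) (k : ℕ) [NeZero k] : IsProbabilityMeasure (uniformProduct ι k) := by
  unfold uniformProduct; infer_instance

theorem uniformProduct_real_cylinder {ι : Type*} {k : ℕ} [NeZero k] (J : Finset ι) (j : Fin k) :
    (uniformProduct ι k).real {σ | ∀ s ∈ J, σ s = j} = ((k : ℝ)⁻¹) ^ J.card := by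
  have : {σ : ι → Fin k | ∀ s ∈ J, σ s = j} = Set.pi J fun _ => {j} := by
    ext σ; simp [Set.mem_pi]
  rw [this, measureReal_def, uniformProduct, Measure.infinitePi_pi _ fun _ _ => .of_discrete]
  simp

/-- The indicator function of the value `j`. -/
noncomputable def valueIndicator {k : ℕ} (j a : Fin k) : ℝ := if a = j then 1 else 0

theorem valueIndicator_mem_Icc {k : ℕ} (j a : Fin k) :
    valueIndicator j a ∈ Set.Icc (0 : ℝ) 1 := by
  unfold valueIndicator; split_ifs <;> simp

theorem continuous_valueIndicator {k : ℕ} (j : Fin k) : Continuous (valueIndicator j) :=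
  continuous_of_discreteTopology

/-- If for all finite `J` and all `σ` some measure `ν` satisfies `c (σ s) l ≤ ∫ φ s (σ s) l ∂ν` for
`s ∈ J`, then a measure on `(ι → Fin k) × X` with uniform independent first coordinates realizes
these inequalities on average, for all `s` at once. -/
theorem exists_joint_measure {ι X : Type*} [Countable ι] {k : ℕ} [NeZero k]
    [TopologicalSpace X] [CompactSpace X] [TopologicalSpace.MetrizableSpace X]
    [MeasurableSpace X] [BorelSpace X] {L : Fin k → Type*}
    (φ : ι → ∀ j, L j → C(X, ℝ)) (c : ∀ j, L j → ℝ)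
    (hyp : ∀ (J : Finset ι) (σ : ι → Fin k), ∃ ν : ProbabilityMeasure X,
      ∀ s ∈ J, ∀ l, c (σ s) l ≤ ∫ x, φ s (σ s) l x ∂(ν : Measure X)) :
    ∃ P : Measure ((ι → Fin k) × X), IsProbabilityMeasure P ∧
      (∀ s j l, c j l * (k : ℝ)⁻¹ ≤ ∫ z, valueIndicator j (z.1 s) * φ s j l z.2 ∂P) ∧
      (∀ s j, ∫ z, valueIndicator j (z.1 s) ∂P = (k : ℝ)⁻¹) ∧
      (∀ s t j, s ≠ t → ∫ z, valueIndicator j (z.1 s) * valueIndicator j (z.1 t) ∂P =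
        (k : ℝ)⁻¹ ^ 2) := by
  classical
  let _ : MetricSpace X := TopologicalSpace.metrizableSpaceMetric X
  let _ : MetricSpace (ι → Fin k) := TopologicalSpace.metrizableSpaceMetric _
  let β := uniformProduct ι k
  have hJ : ∀ (J : Finset ι) (τ : J → Fin k), ∃ ν : ProbabilityMeasure X,
      ∀ s : J, ∀ l, c (τ s) l ≤ ∫ x, φ s (τ s) l x ∂(ν : Measure X) := by
    intro J τ
    obtain ⟨ν, hν⟩ := hyp J (fun s => if h : s ∈ J then τ ⟨s, h⟩ else 0)
    refine ⟨ν, fun s l => ?_⟩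
    have h := hν s s.2
    have e : (if h : (s : ι) ∈ J then τ ⟨s, h⟩ else 0) = τ s := by simp
    rw [e] at h
    exact h l
  choose ν hν using hJ
  -- The chosen measure depends only on the finitely many coordinates in `J`, which makes
  -- measurability automatic.
  let κ : ∀ J : Finset ι, ProbabilityTheory.Kernel (ι → Fin k) X := fun J =>
    (⟨fun τ => (ν J τ : Measure X), measurable_of_countable _⟩ :
      ProbabilityTheory.Kernel (J → Fin k) X).comap (fun σ s => σ s) (by fun_prop)
  have hκ : ∀ J σ, κ J σ = (ν J (fun s => σ s) : Measure X) := fun J σ => rfl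
  have : ∀ J, ProbabilityTheory.IsMarkovKernel (κ J) := fun J =>
    ⟨fun σ => by rw [hκ]; infer_instance⟩
  let Q : Finset ι → ProbabilityMeasure ((ι → Fin k) × X) := fun J =>
    ⟨β.compProd (κ J), inferInstance⟩
  -- Finer than `atTop`, so every fixed `s` eventually lies in `J`; compactness of the space of
  -- probability measures gives the limit `P`.
  let U : Ultrafilter (Finset ι) := Ultrafilter.of Filter.atTop
  obtain ⟨P, -, hP⟩ := (isCompact_univ (X := ProbabilityMeasure ((ι → Fin k) × X))).ultrafilter_le_nhds
    (U.map Q) (by simp)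
  have hP' : Filter.Tendsto Q U (𝓝 P) := hP
  have lim : ∀ h : (ι → Fin k) × X → ℝ, Continuous h →
      Filter.Tendsto (fun J => ∫ z, h z ∂(Q J : Measure ((ι → Fin k) × X))) U
        (𝓝 (∫ z, h z ∂(P : Measure ((ι → Fin k) × X)))) := fun h hh =>
    ProbabilityMeasure.tendsto_iff_forall_integral_tendsto.1 hP'
      (BoundedContinuousFunction.mkOfCompact ⟨h, hh⟩)
  have int : ∀ (J : Finset ι) (h : (ι → Fin k) × X → ℝ), Continuous h →
      Integrable h (Q J : Measure ((ι → Fin k) × X)) := fun J h hh =>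
    (BoundedContinuousFunction.mkOfCompact ⟨h, hh⟩).integrable _
  have comp : ∀ (J : Finset ι) (h : (ι → Fin k) × X → ℝ), Continuous h →
      ∫ z, h z ∂(Q J : Measure ((ι → Fin k) × X)) = ∫ σ, ∫ x, h (σ, x) ∂(κ J σ) ∂β :=
    fun J h hh => Measure.integral_compProd (int J h hh)
  have intκ : ∀ (J : Finset ι) (h : (ι → Fin k) × X → ℝ), Continuous h →
      Integrable (fun σ => ∫ x, h (σ, x) ∂(κ J σ)) β := fun J h hh => by
    simpa using Integrable.integral_compProd (κ := ProbabilityTheory.Kernel.const Unit β)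
      (η := ProbabilityTheory.Kernel.prodMkLeft Unit (κ J)) (a := ()) (int J h hh)
  have hev : ∀ s, ∀ᶠ J in (U : Filter (Finset ι)), s ∈ J := fun s =>
    Ultrafilter.of_le Filter.atTop ((Filter.eventually_ge_atTop {s}).mono fun J h => by simpa using h)
  have ce : ∀ (s : ι) (j : Fin k), Continuous fun z : (ι → Fin k) × X =>
      valueIndicator j (z.1 s) := fun s j =>
    (continuous_of_discreteTopology (f := valueIndicator j)).comp
      ((continuous_apply s).comp continuous_fst)
  have me : ∀ (s : ι) (j : Fin k), Measurable fun σ : ι → Fin k =>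
      valueIndicator j (σ s) := fun s j =>
    (measurable_from_top (f := valueIndicator j)).comp
      (measurable_pi_apply s)
  have int1 : ∀ s j, ∫ σ, valueIndicator j (σ s) ∂β = (k : ℝ)⁻¹ := by
    intro s j
    have h := uniformProduct_real_cylinder (k := k) {s} j
    simp only [Finset.mem_singleton, forall_eq, Finset.card_singleton, pow_one] at h
    rw [← h, ← integral_indicator_one (measurableSet_eq_fun (by fun_prop) (by fun_prop))]
    congr 1
    ext σ
    simp [Set.indicator_apply, valueIndicator]
  have int2 : ∀ s t j, s ≠ t →
      ∫ σ, valueIndicator j (σ s) * valueIndicator j (σ t) ∂β = (k : ℝ)⁻¹ ^ 2 := by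
    intro s t j hst
    have h := uniformProduct_real_cylinder (k := k) {s, t} j
    rw [Finset.card_pair hst] at h
    have hm : MeasurableSet {σ : ι → Fin k | ∀ u ∈ ({s, t} : Finset ι), σ u = j} := by
      simp only [Finset.mem_insert, Finset.mem_singleton, forall_eq_or_imp, forall_eq]
      exact (measurableSet_eq_fun (by fun_prop) (by fun_prop)).inter
        (measurableSet_eq_fun (by fun_prop) (by fun_prop))
    rw [← h, ← integral_indicator_one hm]
    congr 1
    ext σ
    by_cases h1 : σ s = j <;> by_cases h2 : σ t = j <;> simp [valueIndicator, h1, h2]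
  refine ⟨P, inferInstance, fun s j l => ?_, fun s j => ?_, fun s t j hst => ?_⟩
  · have hc : Continuous fun z : (ι → Fin k) × X => valueIndicator j (z.1 s) * φ s j l z.2 :=
      (ce s j).mul (by fun_prop)
    refine ge_of_tendsto (lim _ hc) ((hev s).mono fun J hs => ?_)
    rw [comp J _ hc, mul_comm, ← int1 s j, ← integral_mul_const]
    refine integral_mono ?_ (intκ J _ hc) fun σ => ?_
    · exact (Integrable.of_bound (me s j).aestronglyMeasurable 1 (.of_forall fun σ => by
        rw [Real.norm_of_nonneg (valueIndicator_mem_Icc _ _).1]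
        exact (valueIndicator_mem_Icc _ _).2)).mul_const _
    · dsimp only
      rw [integral_const_mul, hκ, valueIndicator]
      by_cases h : σ s = j
      · subst h
        simpa using hν J (fun s => σ s) ⟨s, hs⟩ l
      · simp [h]
  · refine tendsto_nhds_unique (lim _ (ce s j)) (tendsto_const_nhds.congr fun J => ?_)
    rw [comp J _ (ce s j)]
    simp [int1]
  · have hc : Continuous fun z : (ι → Fin k) × X =>
        valueIndicator j (z.1 s) * valueIndicator j (z.1 t) := (ce s j).mul (ce t j)
    refine tendsto_nhds_unique (lim _ hc) (tendsto_const_nhds.congr fun J => ?_)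
    rw [comp J _ hc]
    simpa using (int2 s t j hst).symm

/-! ### Infinite independent subsets from weak limits -/

/-- A property of finite sets that can always be extended by a new element holds for a cofinal
family of finite subsets of some infinite set. -/
theorem exists_infinite_of_forall_exists_insert {ι : Type*} [DecidableEq ι] (Q : Finset ι → Prop)
    (h0 : Q ∅) (hQ : ∀ J, Q J → ∃ s, s ∉ J ∧ Q (insert s J)) :
    ∃ H : Set ι, H.Infinite ∧ ∀ J : Finset ι, (J : Set ι) ⊆ H → ∃ J', J ⊆ J' ∧ Q J' := by
  have : Nonempty ι := ⟨(hQ ∅ h0).choose⟩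
  choose! s hs hs' using hQ
  obtain ⟨A, hA0, hAs⟩ : ∃ A : ℕ → Finset ι, A 0 = ∅ ∧ ∀ n, A (n + 1) = insert (s (A n)) (A n) :=
    ⟨fun n => Nat.rec ∅ (fun _ J => insert (s J) J) n, rfl, fun _ => rfl⟩
  have hA : ∀ n, Q (A n) := by
    intro n
    induction n with
    | zero => rwa [hA0]
    | succ n ih => rw [hAs]; exact hs' _ ih
  have hmono : Monotone A := monotone_nat_of_le_succ fun n => by
    rw [hAs]; exact Finset.subset_insert _ _
  have hcard : ∀ n, (A n).card = n := by
    intro n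
    induction n with
    | zero => simp [hA0]
    | succ n ih => rw [hAs, Finset.card_insert_of_notMem (hs _ (hA n)), ih]
  refine ⟨{x | ∃ n, x ∈ A n}, fun hfin => ?_, fun J hJ => ?_⟩
  · have h : A (hfin.toFinset.card + 1) ⊆ hfin.toFinset := fun x hx => by
      rw [Set.Finite.mem_toFinset]
      exact ⟨_, hx⟩
    have h' := Finset.card_le_card h
    rw [hcard] at h'
    omega
  · choose! n hn using hJ
    exact ⟨A (J.sup n), fun x hx => hmono (Finset.le_sup hx) (hn hx), hA _⟩

open Filter in
/-- Pairwise independent functions with constant mean converge weakly to their mean. -/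
theorem weak_limit_ae_eq_const {Z ι : Type*} [MeasurableSpace Z] (P : Measure Z)
    [IsProbabilityMeasure P] (U : Ultrafilter ι) (hU : (U : Filter ι) ≤ cofinite)
    (v : ι → Z → ℝ) (hv : ∀ s, Measurable (v s)) (hv1 : ∀ s z, v s z ∈ Set.Icc (0 : ℝ) 1) (p : ℝ)
    (h1 : ∀ s, ∫ z, v s z ∂P = p) (h2 : ∀ s t, s ≠ t → ∫ z, v s z * v t z ∂P = p ^ 2)
    (e : Z → ℝ) (he : Measurable e) (he1 : ∀ z, e z ∈ Set.Icc (0 : ℝ) 1)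
    (hlim : ∀ (h : Z → ℝ) (C : ℝ), Measurable h → (∀ z, |h z| ≤ C) →
        Tendsto (fun s => ∫ z, h z * v s z ∂P) U (𝓝 (∫ z, h z * e z ∂P))) :
    e =ᵐ[P] fun _ => p := by
  have abs1 : ∀ {x : ℝ}, x ∈ Set.Icc (0 : ℝ) 1 → |x| ≤ 1 := fun hx =>
    abs_le.2 ⟨by linarith [hx.1], hx.2⟩
  have e1 : ∫ z, e z ∂P = p := by
    have := hlim (fun _ => 1) 1 measurable_const (by simp)
    simp only [one_mul, h1] at this
    exact (tendsto_nhds_unique this tendsto_const_nhds)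
  have e2 : ∀ t, ∫ z, e z * v t z ∂P = p ^ 2 := by
    -- For fixed `t` the ultrafilter ignores `s = t`, so the limit is `p ^ 2`. Testing next against
    -- `e` itself gives `∫ e² = p ^ 2`, and the variance of `e` vanishes.
    intro t
    have := hlim (v t) 1 (hv t) fun z => abs1 (hv1 t z)
    simp only [mul_comm (e _)]
    refine tendsto_nhds_unique this (tendsto_const_nhds.congr' ?_)
    have : ∀ᶠ s in (U : Filter ι), s ≠ t := hU (by simp [Set.compl_def])
    filter_upwards [this] with s hs
    exact (h2 t s hs.symm).symm
  have e3 : ∫ z, e z * e z ∂P = p ^ 2 := by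
    have := hlim e 1 he fun z => abs1 (he1 z)
    simp only [e2] at this
    exact tendsto_nhds_unique this tendsto_const_nhds
  have ei : Integrable e P := .of_bound he.aestronglyMeasurable 1 (.of_forall fun z => abs1 (he1 z))
  have eei : Integrable (fun z => e z * e z) P :=
    .of_bound (he.mul he).aestronglyMeasurable 1 (.of_forall fun z => by
      rw [norm_mul]; exact mul_le_one₀ (abs1 (he1 z)) (norm_nonneg _) (abs1 (he1 z)))
  have e4 : ∫ z, (e z - p) ^ 2 ∂P = 0 := by
    have : ∀ z, (e z - p) ^ 2 = e z * e z - 2 * p * e z + p ^ 2 := fun z => by ring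
    simp only [this]
    have e2' : ∫ z, (e z * e z - 2 * p * e z) ∂P = p ^ 2 - 2 * p * p := by
      rw [integral_sub eei (ei.const_mul _), integral_const_mul, e1, e3]
    have hi : Integrable (fun z => e z * e z - 2 * p * e z) P := eei.sub (ei.const_mul _)
    rw [integral_add hi (integrable_const _), e2']
    simp; ring
  have e5 := (integral_eq_zero_iff_of_nonneg (fun z => sq_nonneg (e z - p)) (by
    have : ∀ z, (e z - p) ^ 2 = e z * e z - 2 * p * e z + p ^ 2 := fun z => by ring
    simp only [this]
    exact (eei.sub (ei.const_mul _)).add (integrable_const _))).1 e4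
  filter_upwards [e5] with z hz
  have : (e z - p) ^ 2 = 0 := hz
  nlinarith [pow_eq_zero_iff (two_ne_zero) |>.1 this]

open Filter in
/-- Where the weak limits of finitely many sequences are positive, some infinite subset of the
index set is independent for these sequences. -/
theorem exists_infinite_forall_integral_prod_pos {Z ι K T : Type*} [MeasurableSpace Z]
    [Finite K] [Finite T] (P : Measure Z) [IsProbabilityMeasure P] (U : Ultrafilter ι)
    (hU : (U : Filter ι) ≤ cofinite) (ψ : T → ι → K → Z → ℝ) (hψ : ∀ t s j, Measurable (ψ t s j))
    (hψ1 : ∀ t s j z, ψ t s j z ∈ Set.Icc (0 : ℝ) 1) (f : T → K → Z → ℝ)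
    (hf : ∀ t j, Measurable (f t j)) (hf1 : ∀ t j z, f t j z ∈ Set.Icc (0 : ℝ) 1)
    (hlim : ∀ t j (h : Z → ℝ) (C : ℝ), Measurable h → (∀ z, |h z| ≤ C) →
        Tendsto (fun s => ∫ z, h z * ψ t s j z ∂P) U (𝓝 (∫ z, h z * f t j z ∂P)))
    (hpos : ∀ t, P {z | ∀ j, 0 < f t j z} ≠ 0) :
    ∃ H : Set ι, H.Infinite ∧ ∀ t, ∀ J : Finset ι, (J : Set ι) ⊆ H → ∀ τ : ι → K,
      ∃ z, ∀ s ∈ J, 0 < ψ t s (τ s) z := by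
  classical
  let G : T → Set Z := fun t => {z | ∀ j, 0 < f t j z}
  have hG : ∀ t, MeasurableSet (G t) := fun t => by
    have : G t = ⋂ j, {z | 0 < f t j z} := by ext; simp [G]
    rw [this]
    exact .iInter fun j => measurableSet_lt measurable_const (hf t j)
  -- Restricting to `G t` ensures that every `f t j` is positive on the support of `h`. Hence `∫ h *
  -- f t j` stays positive, and any value can be imposed at the next element.
  let h : T → Finset ι → (ι → K) → Z → ℝ := fun t J τ =>
    (G t).indicator fun z => ∏ s ∈ J, ψ t s (τ s) z
  have hm : ∀ t J τ, Measurable (h t J τ) := fun t J τ =>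
    (Finset.measurable_prod _ fun s _ => hψ t s (τ s)).indicator (hG t)
  have hnn : ∀ t J τ z, 0 ≤ h t J τ z := fun t J τ z =>
    Set.indicator_nonneg (fun z _ => Finset.prod_nonneg fun s _ => (hψ1 t s (τ s) z).1) z
  have hle : ∀ t J τ z, |h t J τ z| ≤ 1 := fun t J τ z => by
    rw [abs_of_nonneg (hnn t J τ z)]
    refine Set.indicator_le' (g := fun _ => (1 : ℝ)) (fun z _ => ?_) (fun z _ => zero_le_one) z
    exact Finset.prod_le_one (fun s _ => (hψ1 t s (τ s) z).1) fun s _ => (hψ1 t s (τ s) z).2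
  have hint : ∀ t J τ, Integrable (h t J τ) P := fun t J τ =>
    .of_bound (hm t J τ).aestronglyMeasurable 1 (.of_forall (hle t J τ))
  let Q : Finset ι → Prop := fun J => ∀ t τ, 0 < ∫ z, h t J τ z ∂P
  have hQ0 : Q ∅ := by
    intro t τ
    have : h t ∅ τ = (G t).indicator 1 := by ext z; simp [h, Set.indicator_apply]
    rw [this, integral_indicator_one (hG t), measureReal_def]
    exact ENNReal.toReal_pos (hpos t) (measure_ne_top _ _)
  have hcongr : ∀ t J (τ τ' : ι → K), (∀ s ∈ J, τ s = τ' s) → h t J τ = h t J τ' := by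
    intro t J τ τ' hτ
    ext z
    simp only [h]
    congr 1
    ext z
    exact Finset.prod_congr rfl fun s hs => by rw [hτ s hs]
  have hstep : ∀ J, Q J → ∃ s, s ∉ J ∧ Q (insert s J) := by
    intro J hJ
    have hev : ∀ t τ j, ∀ᶠ s in (U : Filter ι), 0 < ∫ z, h t J τ z * ψ t s j z ∂P := by
      intro t τ j
      refine (hlim t j (h t J τ) 1 (hm t J τ) (hle t J τ)).eventually_const_lt ?_
      have hfi : Integrable (fun z => h t J τ z * f t j z) P :=
        .of_bound ((hm t J τ).mul (hf t j)).aestronglyMeasurable 1 (.of_forall fun z => by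
          rw [norm_mul]
          refine mul_le_one₀ (hle t J τ z) (norm_nonneg _) ?_
          rw [Real.norm_of_nonneg (hf1 t j z).1]
          exact (hf1 t j z).2)
      rw [integral_pos_iff_support_of_nonneg
        (fun z => mul_nonneg (hnn t J τ z) (hf1 t j z).1) hfi]
      have hJ' := hJ t τ
      rw [integral_pos_iff_support_of_nonneg (hnn t J τ) (hint t J τ)] at hJ'
      refine hJ'.trans_le (measure_mono fun z hz => ?_)
      have hz' : h t J τ z ≠ 0 := hz
      have hzG : z ∈ G t := by
        by_contra hzG
        exact hz' (Set.indicator_of_notMem hzG _)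
      exact mul_ne_zero hz' (hzG j).ne'
    -- Only finitely many patterns on `J` matter, so one `s` serves them all; the value `j` outside
    -- `J` is irrelevant by `hcongr`.
    have hev' : ∀ᶠ s in (U : Filter ι), ∀ t j (τ : J → K),
        0 < ∫ z, h t J (fun s => if hs : s ∈ J then τ ⟨s, hs⟩ else j) z * ψ t s j z ∂P := by
      simp only [eventually_all]
      intro t j τ
      exact hev t _ j
    have hnot : ∀ᶠ s in (U : Filter ι), s ∉ J := hU J.finite_toSet.compl_mem_cofinite
    obtain ⟨s, hs, hsJ⟩ := (hev'.and hnot).exists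
    refine ⟨s, hsJ, fun t τ => ?_⟩
    have := hs t (τ s) fun s => τ s
    rw [hcongr t J _ τ fun s hs => by simp [hs]] at this
    convert this using 3 with z
    by_cases hz : z ∈ G t
    · simp only [h, Set.indicator_of_mem hz]
      rw [Finset.prod_insert hsJ, mul_comm]
    · simp only [h, Set.indicator_of_notMem hz, zero_mul]
  obtain ⟨H, hH, hH'⟩ := exists_infinite_of_forall_exists_insert Q hQ0 hstep
  refine ⟨H, hH, fun t J hJ τ => ?_⟩
  obtain ⟨J', hJJ', hJ'⟩ := hH' J hJ
  have hp := hJ' t τ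
  obtain ⟨z, hz⟩ : ∃ z, h t J' τ z ≠ 0 := by
    by_contra! hcon
    simp [hcon] at hp
  refine ⟨z, fun s hs => ((hψ1 t s (τ s) z).1).lt_of_ne' fun h0 => hz ?_⟩
  refine Set.indicator_apply_eq_zero.2 fun _ => ?_
  exact Finset.prod_eq_zero (hJJ' hs) h0

/-! ### Coupling together with independent points -/

open Filter in
/-- From measures `ν` realizing all finite patterns of lower bounds on `∫ φ s j l ∂ν`, an
approximate coupling `w` of these bounds and an infinite set `H` such that all patterns on `H` are
realized by points, for all index tuples charged by `w`. -/
theorem exists_coupling_and_independent_points {ι X : Type*} [Countable ι] [Infinite ι] {k : ℕ}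
    [NeZero k] [TopologicalSpace X] [CompactSpace X] [TopologicalSpace.MetrizableSpace X]
    [MeasurableSpace X] [BorelSpace X] {L : Fin k → Type*} [∀ j, Fintype (L j)]
    [∀ j, DecidableEq (L j)] (φ : ι → ∀ j, L j → C(X, ℝ)) (h0 : ∀ s j l x, 0 ≤ φ s j l x)
    (hs : ∀ s j x, ∑ l, φ s j l x ≤ 1) (c : ∀ j, L j → ℝ)
    (hyp : ∀ (J : Finset ι) (σ : ι → Fin k), ∃ ν : ProbabilityMeasure X,
      ∀ s ∈ J, ∀ l, c (σ s) l ≤ ∫ x, φ s (σ s) l x ∂(ν : Measure X)) :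
    ∃ w : (∀ j, L j) → ℝ, (∀ i, 0 ≤ w i) ∧ ∑ i, w i ≤ 1 ∧
      (∀ j l, c j l - ∑ j', (1 - ∑ l', c j' l') ≤ ∑ i : ∀ j, L j with i j = l, w i) ∧
      ∃ H : Set ι, H.Infinite ∧ ∀ i, 0 < w i → ∀ J : Finset ι, (J : Set ι) ⊆ H →
        ∀ τ : ι → Fin k, ∃ x, ∀ s ∈ J, 0 < φ s (τ s) (i (τ s)) x := by
  classical
  obtain ⟨P, hP, hP1, hP2, hP3⟩ := exists_joint_measure φ c hyp
  have hk : (0 : ℝ) < k := by exact_mod_cast Nat.pos_of_ne_zero (NeZero.ne k)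
  let U : Ultrafilter ι := hyperfilter ι
  have hU : (U : Filter ι) ≤ cofinite := hyperfilter_le_cofinite
  have hφ1 : ∀ s j l x, φ s j l x ≤ 1 := fun s j l x =>
    (Finset.single_le_sum (f := fun l => φ s j l x) (fun l _ => h0 s j l x)
      (Finset.mem_univ l)).trans (hs s j x)
  let v : Fin k → ι → (ι → Fin k) × X → ℝ := fun j s z => valueIndicator j (z.1 s)
  let ψ : ∀ j, L j → ι → (ι → Fin k) × X → ℝ := fun j l s z => v j s z * φ s j l z.2
  have hv : ∀ j s, Measurable (v j s) := fun j s =>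
    (continuous_valueIndicator j).measurable.comp ((measurable_pi_apply s).comp measurable_fst)
  have hv1 : ∀ j s z, v j s z ∈ Set.Icc (0 : ℝ) 1 := fun j s z => valueIndicator_mem_Icc _ _
  have hψ : ∀ j l s, Measurable (ψ j l s) := fun j l s =>
    (hv j s).mul ((φ s j l).continuous.measurable.comp measurable_snd)
  have hψ1 : ∀ j l s z, ψ j l s z ∈ Set.Icc (0 : ℝ) 1 := fun j l s z =>
    ⟨mul_nonneg (hv1 j s z).1 (h0 _ _ _ _),
      mul_le_one₀ (hv1 j s z).2 (h0 _ _ _ _) (hφ1 _ _ _ _)⟩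
  choose f hf hf1 hflim using fun j l => exists_weak_limit_of_mem_Icc P U (ψ j l) (hψ j l) (hψ1 j l)
  choose e he he1 helim using fun j => exists_weak_limit_of_mem_Icc P U (v j) (hv j) (hv1 j)
  have hek : ∀ j, e j =ᵐ[P] fun _ => (k : ℝ)⁻¹ := fun j =>
    weak_limit_ae_eq_const P U hU (v j) (hv j) (hv1 j) _ (fun s => hP2 s j)
      (fun s t hst => hP3 s t j hst) (e j) (he j) (he1 j) (helim j)
  have bint : ∀ q : (ι → Fin k) × X → ℝ, Measurable q → (∀ z, q z ∈ Set.Icc (0 : ℝ) 1) →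
      Integrable q P := fun q hq hq1 =>
    .of_bound hq.aestronglyMeasurable 1 (.of_forall fun z => by
      rw [Real.norm_of_nonneg (hq1 z).1]; exact (hq1 z).2)
  have setInt : ∀ (E : Set ((ι → Fin k) × X)), MeasurableSet E → ∀ q : (ι → Fin k) × X → ℝ,
      ∫ z, E.indicator 1 z * q z ∂P = ∫ z in E, q z ∂P := by
    intro E hE q
    rw [← integral_indicator hE]
    congr 1; ext z
    by_cases hz : z ∈ E <;> simp [hz]
  -- The pointwise bound `∑ l, ψ j l s ≤ v j s` passes to the weak limits after integration over
  -- each measurable set.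
  have hfe : ∀ j, (fun z => ∑ l, f j l z) ≤ᵐ[P] e j := by
    intro j
    refine ae_le_of_forall_setIntegral_le
      (integrable_finsetSum _ fun l _ => bint _ (hf j l) (hf1 j l)) (bint _ (he j) (he1 j))
      fun E hE _ => ?_
    have hEm : Measurable (E.indicator (1 : (ι → Fin k) × X → ℝ)) := measurable_one.indicator hE
    have hE1 : ∀ z, |E.indicator (1 : (ι → Fin k) × X → ℝ) z| ≤ 1 := fun z => by
      by_cases hz : z ∈ E <;> simp [hz]
    have t1 := helim j _ 1 hEm hE1
    have t2 := tendsto_finsetSum Finset.univ fun l _ => hflim j l _ 1 hEm hE1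
    simp only [setInt E hE] at t1 t2
    rw [integral_finsetSum _ fun l _ => (bint _ (hf j l) (hf1 j l)).integrableOn]
    refine le_of_tendsto_of_tendsto' t2 t1 fun s => ?_
    rw [← integral_finsetSum _ fun l _ => (bint _ (hψ j l s) (hψ1 j l s)).integrableOn]
    refine integral_mono
      (integrable_finsetSum _ fun l _ => (bint _ (hψ j l s) (hψ1 j l s)).integrableOn)
      (bint _ (hv j s) (hv1 j s)).integrableOn fun z => ?_
    change ∑ l, v j s z * φ s j l z.2 ≤ v j s z
    rw [← Finset.mul_sum]
    exact mul_le_of_le_one_right (hv1 j s z).1 (hs s j z.2)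
  -- The factor `k` undoes the probability `1/k` of the event `σ s = j`.
  let g : ∀ j, L j → (ι → Fin k) × X → ℝ := fun j l z => k * f j l z
  have hg0 : ∀ j l z, 0 ≤ g j l z := fun j l z => mul_nonneg hk.le (hf1 j l z).1
  have hgs : ∀ j, ∀ᵐ z ∂P, ∑ l, g j l z ≤ 1 := by
    intro j
    filter_upwards [hfe j, hek j] with z hz hz'
    change ∑ l, k * f j l z ≤ 1
    rw [← Finset.mul_sum]
    calc (k : ℝ) * ∑ l, f j l z ≤ k * e j z := mul_le_mul_of_nonneg_left hz hk.le
      _ = 1 := by rw [hz', mul_inv_cancel₀ hk.ne']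
  have hgc : ∀ j l, c j l ≤ ∫ z, g j l z ∂P := by
    intro j l
    have t := hflim j l (fun _ => 1) 1 measurable_const (by simp)
    simp only [one_mul] at t
    have h1 : c j l * (k : ℝ)⁻¹ ≤ ∫ z, f j l z ∂P := ge_of_tendsto' t fun s => hP1 s j l
    change c j l ≤ ∫ z, k * f j l z ∂P
    rw [integral_const_mul]
    calc c j l = k * (c j l * (k : ℝ)⁻¹) := by field_simp
      _ ≤ _ := mul_le_mul_of_nonneg_left h1 hk.le
  obtain ⟨hw1, hw2⟩ := coupling_weights P g (fun j l => (hf j l).const_mul _) hg0 hgs c hgc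
  let w : (∀ j, L j) → ℝ := fun i => ∫ z, ∏ j, g j (i j) z ∂P
  obtain ⟨H, hH, hH'⟩ := exists_infinite_forall_integral_prod_pos (T := {i // 0 < w i}) P U hU
    (fun i s j => ψ j (i.1 j) s) (fun i s j => hψ _ _ _) (fun i s j => hψ1 _ _ _)
    (fun i j => f j (i.1 j)) (fun i j => hf _ _) (fun i j => hf1 _ _) (fun i j => hflim _ _)
    (by
      rintro ⟨i, hi⟩ hzero
      refine hi.ne' (integral_eq_zero_of_ae ?_)
      have : ∀ᵐ z ∂P, z ∉ {z | ∀ j, 0 < f j (i j) z} := measure_eq_zero_iff_ae_notMem.1 hzero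
      filter_upwards [this] with z hz
      simp only [not_forall, not_lt] at hz
      obtain ⟨j, hj⟩ := hz
      refine Finset.prod_eq_zero (Finset.mem_univ j) ?_
      change k * f j (i j) z = 0
      rw [le_antisymm hj (hf1 _ _ _).1, mul_zero])
  refine ⟨w, fun i => integral_nonneg fun z => Finset.prod_nonneg fun j _ => hg0 _ _ _, hw1, hw2,
    H, hH, fun i hi J hJ τ => ?_⟩
  obtain ⟨z, hz⟩ := hH' ⟨i, hi⟩ J hJ τ
  exact ⟨z.2, fun s hs => pos_of_mul_pos_right (hz s hs) (hv1 _ _ _).1⟩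

/-! ### Finitely supported measures and their neighborhoods -/

/-- A probability measure with atoms `y i` of mass at least `w i`. -/
theorem exists_probabilityMeasure_of_weights {X I : Type*} [TopologicalSpace X] [T1Space X]
    [MeasurableSpace X] [BorelSpace X] [Fintype I] [Nonempty I] (w : I → ℝ) (hw : ∀ i, 0 ≤ w i)
    (hw1 : ∑ i, w i ≤ 1) (y : I → X) :
    ∃ ν : ProbabilityMeasure X, (ν : Measure X).support.encard ≤ Fintype.card I ∧
      ∀ (B : Set X) (s : Finset I), MeasurableSet B → (∀ i ∈ s, 0 < w i → y i ∈ B) →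
        ∑ i ∈ s, w i ≤ (ν : Measure X).real B := by
  classical
  obtain ⟨i₀⟩ := ‹Nonempty I›
  -- The missing mass is put on an arbitrary atom; this only increases the lower bounds.
  let w' : I → ℝ := fun i => w i + if i = i₀ then 1 - ∑ i, w i else 0
  have hle : ∀ i, w i ≤ w' i := fun i => by
    dsimp only [w']; split_ifs <;> linarith
  have hw' : ∀ i, 0 ≤ w' i := fun i => (hw i).trans (hle i)
  have hsum : ∑ i, w' i = 1 := by simp [w', Finset.sum_add_distrib]
  let m : Measure X := ∑ i, ENNReal.ofReal (w' i) • Measure.dirac (y i)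
  have hm : ∀ B, MeasurableSet B →
      m B = ∑ i, ENNReal.ofReal (w' i) * B.indicator 1 (y i) := fun B hB => by
    simp [m, Measure.finsetSum_apply, Measure.dirac_apply' _ hB]
  have hprob : IsProbabilityMeasure m := ⟨by
    rw [hm _ .univ]
    simp only [Set.indicator_univ, Pi.one_apply, mul_one]
    rw [← ENNReal.ofReal_sum_of_nonneg fun i _ => hw' i, hsum, ENNReal.ofReal_one]⟩
  refine ⟨⟨m, hprob⟩, ?_, fun B s hB hs => ?_⟩
  · have hcl : IsClosed (Set.range y) := (Set.finite_range y).isClosed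
    have hsub : m.support ⊆ Set.range y := by
      refine Measure.support_subset_of_isClosed hcl ?_
      rw [mem_ae_iff, hm _ hcl.measurableSet.compl]
      simp
    calc m.support.encard ≤ (Set.range y).encard := Set.encard_le_encard hsub
      _ ≤ (Set.univ : Set I).encard := by rw [← Set.image_univ]; exact Set.encard_image_le _ _
      _ = Fintype.card I := by simp [Set.encard_univ]
  · change _ ≤ (m B).toReal
    rw [← ENNReal.ofReal_le_iff_le_toReal (measure_ne_top m B), hm B hB,
      ENNReal.ofReal_sum_of_nonneg fun i _ => hw i]
    refine (Finset.sum_le_sum fun i hi => ?_).trans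
      (Finset.sum_le_sum_of_subset (Finset.subset_univ s))
    rcases (hw i).eq_or_lt with h | h
    · simp [← h]
    · simpa [hs i hi h] using ENNReal.ofReal_le_ofReal (hle i)

open Filter in
/-- Lower bounds on the masses of small neighborhoods of the atoms of a finitely supported
probability measure define a neighborhood of this measure. -/
theorem exists_nhds_atoms_of_mem_nhds {X : Type*} [TopologicalSpace X]
    [TopologicalSpace.MetrizableSpace X] [MeasurableSpace X] [BorelSpace X]
    (μ : ProbabilityMeasure X) (S : Finset X) (hS : (μ : Measure X) (S : Set X)ᶜ = 0)
    {U : Set (ProbabilityMeasure X)} (hU : U ∈ 𝓝 μ) :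
    ∃ ε > 0, ∃ V : X → Set X, (∀ x, IsOpen (V x) ∧ x ∈ V x) ∧ (S : Set X).PairwiseDisjoint V ∧
      ∀ ν : ProbabilityMeasure X,
        (∀ x ∈ S, (μ : Measure X).real {x} - ε ≤ (ν : Measure X).real (V x)) → ν ∈ U := by
  classical
  let _ : MetricSpace X := TopologicalSpace.metrizableSpaceMetric X
  obtain ⟨W, hW, hWd⟩ := S.finite_toSet.t2_separation
  -- Otherwise radii and errors `1/(n+1)` give counterexamples `ν n` outside `U`. The portmanteau
  -- criterion on open sets shows that they converge to `μ`.
  by_contra! hcon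
  let V : ℕ → X → Set X := fun n x => Metric.ball x (1 / ((n : ℝ) + 1)) ∩ W x
  have hV : ∀ n x, IsOpen (V n x) ∧ x ∈ V n x := fun n x =>
    ⟨Metric.isOpen_ball.inter (hW x).2, Metric.mem_ball_self Nat.one_div_pos_of_nat, (hW x).1⟩
  have hVd : ∀ n, (S : Set X).PairwiseDisjoint (V n) := fun n =>
    hWd.mono fun x => Set.inter_subset_right
  choose ν hν hνU using fun n : ℕ => hcon (1 / ((n : ℝ) + 1)) Nat.one_div_pos_of_nat (V n) (hV n)
    (hVd n)
  have hlim : Tendsto ν atTop (𝓝 μ) := by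
    refine tendsto_of_forall_isOpen_le_liminf_nat' fun G hG => ?_
    let T : Finset X := S.filter (· ∈ G)
    have hμG : (μ : Measure X) G = ENNReal.ofReal (∑ x ∈ T, (μ : Measure X).real {x}) := by
      have h1 : (μ : Measure X) G = (μ : Measure X) (T : Set X) := by
        refine le_antisymm ?_ (measure_mono fun x hx => (Finset.mem_filter.1 hx).2)
        calc (μ : Measure X) G ≤ (μ : Measure X) ((T : Set X) ∪ (S : Set X)ᶜ) :=
              measure_mono fun x hx => by
                by_cases hxS : x ∈ S
                · exact Or.inl (Finset.mem_filter.2 ⟨hxS, hx⟩)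
                · exact Or.inr hxS
          _ ≤ (μ : Measure X) (T : Set X) + (μ : Measure X) (S : Set X)ᶜ := measure_union_le _ _
          _ = (μ : Measure X) (T : Set X) := by rw [hS, add_zero]
      rw [sum_measureReal_singleton, h1, measureReal_def, ENNReal.ofReal_toReal (measure_ne_top _ _)]
    have hev : ∀ᶠ n : ℕ in atTop, ∀ x ∈ T, Metric.ball x (1 / ((n : ℝ) + 1)) ⊆ G := by
      rw [Finset.eventually_all]
      intro x hx
      obtain ⟨r, hr, hrG⟩ := Metric.isOpen_iff.1 hG x (Finset.mem_filter.1 hx).2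
      filter_upwards [(tendsto_one_div_add_atTop_nhds_zero_nat (𝕜 := ℝ)).eventually_lt_const hr]
        with n hn
      exact (Metric.ball_subset_ball hn.le).trans hrG
    have hb : Tendsto (fun n : ℕ => ENNReal.ofReal (∑ x ∈ T, ((μ : Measure X).real {x} -
        1 / ((n : ℝ) + 1)))) atTop (𝓝 ((μ : Measure X) G)) := by
      rw [hμG]
      refine ENNReal.tendsto_ofReal (tendsto_finsetSum _ fun x _ => ?_)
      simpa using tendsto_const_nhds.sub (tendsto_one_div_add_atTop_nhds_zero_nat (𝕜 := ℝ))
    rw [← hb.liminf_eq]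
    refine liminf_le_liminf ?_
    filter_upwards [hev] with n hn
    have hTS : (T : Set X) ⊆ S := fun x hx => (Finset.mem_filter.1 hx).1
    calc ENNReal.ofReal (∑ x ∈ T, ((μ : Measure X).real {x} - 1 / ((n : ℝ) + 1)))
        ≤ ENNReal.ofReal (∑ x ∈ T, (ν n : Measure X).real (V n x)) :=
          ENNReal.ofReal_le_ofReal (Finset.sum_le_sum fun x hx => hν n x (hTS hx))
      _ = ENNReal.ofReal ((ν n : Measure X).real (⋃ x ∈ T, V n x)) := by
          rw [measureReal_biUnion_finset ((hVd n).subset hTS)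
            fun x _ => (hV n x).1.measurableSet]
      _ = (ν n : Measure X) (⋃ x ∈ T, V n x) := by
          rw [measureReal_def, ENNReal.ofReal_toReal (measure_ne_top _ _)]
      _ ≤ (ν n : Measure X) G := measure_mono (Set.iUnion₂_subset fun x hx =>
          Set.inter_subset_left.trans (hn x hx))
  obtain ⟨n, hn⟩ := (hlim.eventually hU).exists
  exact hνU n hn

/-- Pairwise disjoint open neighborhoods of finitely many points carry bump functions with sum at
most `1`. -/
theorem exists_bump_functions {X : Type*} [TopologicalSpace X] [T1Space X] [NormalSpace X]
    (S : Finset X) (V : X → Set X) (hV : ∀ x, IsOpen (V x) ∧ x ∈ V x)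
    (hd : (S : Set X).PairwiseDisjoint V) :
    ∃ φ : S → C(X, ℝ), (∀ l x, 0 ≤ φ l x) ∧ (∀ l : S, φ l l = 1) ∧
      (∀ (l : S) x, 0 < φ l x → x ∈ V l) ∧ ∀ x, ∑ l, φ l x ≤ 1 := by
  have h : ∀ l : S, ∃ f : C(X, ℝ), Set.EqOn f 0 (V l)ᶜ ∧ Set.EqOn f 1 {(l : X)} ∧
      ∀ x, f x ∈ Set.Icc (0 : ℝ) 1 := fun l =>
    exists_continuous_zero_one_of_isClosed (hV l).1.isClosed_compl isClosed_singleton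
      (Set.disjoint_singleton_right.2 fun h => h (hV l).2)
  choose φ h0 h1 h01 using h
  have hVφ : ∀ (l : S) x, 0 < φ l x → x ∈ V l := fun l x hx => by
    by_contra hxV
    exact hx.ne' (h0 l hxV)
  refine ⟨φ, fun l x => (h01 l x).1, fun l => h1 l rfl, hVφ, fun x => ?_⟩
  -- By disjointness at most one bump is nonzero at `x`.
  by_cases hx : ∃ l, 0 < φ l x
  · obtain ⟨l, hl⟩ := hx
    rw [Finset.sum_eq_single l]
    · exact (h01 l x).2
    · intro l' _ hne
      by_contra hl'
      have h2 := hVφ l' x ((h01 l' x).1.lt_of_ne' hl')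
      exact Set.disjoint_left.1 (hd l'.2 l.2 fun h => hne (Subtype.ext h)) h2 (hVφ l x hl)
    · simp
  · push Not at hx
    exact (Finset.sum_nonpos fun l _ => hx l).trans zero_le_one

/-! ### The theorem on IT-tuples -/

theorem mainTheorem10 {Γ X : Type*} [Group Γ] [Countable Γ] [Infinite Γ]
    [TopologicalSpace X] [CompactSpace X] [TopologicalSpace.MetrizableSpace X]
    [MeasurableSpace X] [BorelSpace X] [MulAction Γ X] [ContinuousConstSMul Γ X]
    (k : ℕ) (hk : 1 ≤ k) (N : Fin k → ℕ) (hN : ∀ j, 1 ≤ N j) :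
    (Set.univ.pi fun j => finSuppMeasures X (N j)) ∩ ITTuples Γ (ProbabilityMeasure X) k ⊆
      (fun (ν : Fin k → finSuppMeasures X (∏ j, N j)) (j : Fin k) =>
        (ν j : ProbabilityMeasure X)) '' ITTuples Γ (finSuppMeasures X (∏ j, N j)) k := by
  classical
  rintro μ ⟨hμ, hIT⟩
  have hμN : ∀ j, (μ j : Measure X).support.encard ≤ N j := fun j => hμ j trivial
  have hle : ∀ j, N j ≤ ∏ j, N j := fun j =>
    Nat.le_of_dvd (Finset.prod_pos fun j _ => hN j) (Finset.dvd_prod_of_mem N (Finset.mem_univ j))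
  refine ⟨fun j => ⟨μ j, (hμN j).trans (by exact_mod_cast hle j)⟩, fun U hU => ?_, rfl⟩
  have : NeZero k := ⟨by omega⟩
  let _ : MetricSpace X := TopologicalSpace.metrizableSpaceMetric X
  have hS : ∀ j, ∃ S : Finset X, (μ j : Measure X) (S : Set X)ᶜ = 0 ∧ S.card ≤ N j := fun j => by
    have hfin : (μ j : Measure X).support.Finite := Set.finite_of_encard_le_coe (hμN j)
    refine ⟨hfin.toFinset, by simp, ?_⟩
    have h := hμN j
    rw [hfin.encard_eq_coe_toFinset_card] at h
    exact_mod_cast h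
  choose S hS0 hScard using hS
  have hSsum : ∀ j, ∑ l : S j, (μ j : Measure X).real {(l : X)} = 1 := fun j => by
    rw [Finset.sum_coe_sort (S j) fun x => (μ j : Measure X).real {x}, sum_measureReal_singleton,
      measureReal_def, (prob_compl_eq_zero_iff (S j).measurableSet).1 (hS0 j)]
    rfl
  have hSne : ∀ j, Nonempty (S j) := fun j => by
    by_contra h
    rw [not_nonempty_iff] at h
    have h1 := hSsum j
    rw [Finset.univ_eq_empty, Finset.sum_empty] at h1
    exact zero_ne_one h1
  have hU' : ∀ j, ∃ W ∈ 𝓝 (μ j), ∀ ν : finSuppMeasures X (∏ j, N j), ↑ν ∈ W → ν ∈ U j := fun j => by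
    obtain ⟨W, hW, hWU⟩ := mem_nhds_subtype _ _ _ |>.1 (hU j)
    exact ⟨W, hW, fun ν hν => hWU hν⟩
  choose W hW hWU using hU'
  choose δ hδ V hV hVd hVW using fun j => exists_nhds_atoms_of_mem_nhds (μ j) (S j) (hS0 j) (hW j)
  choose φ h0 h1 hφV hφs using fun j => exists_bump_functions (S j) (V j) (hV j) (hVd j)
  obtain ⟨δ₀, hδ₀, hδle⟩ : ∃ δ₀ > 0, ∀ j, δ₀ ≤ δ j := by
    obtain ⟨j, hj⟩ := Finite.exists_min δ
    exact ⟨δ j, hδ j, hj⟩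
  -- Lowering each atom by `ε` costs `ε` directly, plus the total deficit `∑ j, (S j).card * ε` in
  -- the coupling; together these must not exceed `δ₀`.
  obtain ⟨ε, hε, hεδ⟩ : ∃ ε > 0, ε + ∑ j, ((S j).card : ℝ) * ε = δ₀ := by
    have hM : 0 < 1 + ∑ j, ((S j).card : ℝ) :=
      add_pos_of_pos_of_nonneg one_pos (Finset.sum_nonneg fun j _ => Nat.cast_nonneg _)
    refine ⟨δ₀ / (1 + ∑ j, ((S j).card : ℝ)), div_pos hδ₀ hM, ?_⟩
    rw [← Finset.sum_mul, ← one_add_mul, mul_div_cancel₀ _ hM.ne']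
  let c : ∀ j, S j → ℝ := fun j l => (μ j : Measure X).real {(l : X)} - ε
  let A : Fin k → Set (ProbabilityMeasure X) := fun j =>
    {ν | ∀ l : S j, c j l < ∫ x, φ j l x ∂(ν : Measure X)}
  have hcont : ∀ f : C(X, ℝ), Continuous fun ν : ProbabilityMeasure X => ∫ x, f x ∂(ν : Measure X) :=
    fun f => continuous_iff_continuousAt.2 fun ν =>
      ProbabilityMeasure.tendsto_iff_forall_integral_tendsto.1 Filter.tendsto_id
        (BoundedContinuousFunction.mkOfCompact f)
  have hA : ∀ j, A j ∈ 𝓝 (μ j) := by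
    intro j
    have : A j = ⋂ l : S j, {ν : ProbabilityMeasure X | c j l < ∫ x, φ j l x ∂(ν : Measure X)} := by ext; simp [A]
    rw [this]
    refine Filter.iInter_mem.2 fun l => (isOpen_lt continuous_const (hcont _)).mem_nhds ?_
    change (μ j : Measure X).real {(l : X)} - ε < _
    have h2 : (μ j : Measure X).real {(l : X)} ≤ ∫ x, φ j l x ∂(μ j : Measure X) := by
      rw [← integral_indicator_one (measurableSet_singleton _)]
      refine integral_mono ((integrable_const 1).indicator (measurableSet_singleton _))
        ((BoundedContinuousFunction.mkOfCompact (φ j l)).integrable _) fun x => ?_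
      refine Set.indicator_le' (fun y hy => ?_) (fun y _ => h0 j l y) x
      rw [Set.mem_singleton_iff.1 hy, h1]
      rfl
    linarith
  obtain ⟨F, hF, hFA⟩ := hIT A hA
  have : Infinite F := hF.to_subtype
  obtain ⟨w, hw0, hw1, hwc, H, hH, hHφ⟩ := exists_coupling_and_independent_points (ι := F)
    (fun s j l => (φ j l).comp ⟨fun x => (s : Γ) • x, continuous_const_smul _⟩)
    (fun s j l x => h0 j l _) (fun s j x => hφs j _) c (by
      intro J σ
      -- Independence concerns nonempty sets only; for `J = ∅` any measure will do.
      rcases J.eq_empty_or_nonempty with rfl | hJ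
      · exact ⟨μ 0, by simp⟩
      obtain ⟨ν, hν⟩ := hFA (J.map (Function.Embedding.subtype _)) (hJ.map)
        (fun g hg => by
          obtain ⟨s, -, rfl⟩ := Finset.mem_map.1 hg
          exact s.2)
        (fun g => if h : (g : Γ) ∈ F then σ ⟨g, h⟩ else 0)
      refine ⟨ν, fun s hs l => ?_⟩
      have h := Set.mem_iInter.1 hν ⟨s, Finset.mem_map_of_mem _ hs⟩
      have e : (if h : (s : Γ) ∈ F then σ ⟨s, h⟩ else 0) = σ s := by simp
      change (s : Γ) • ν ∈ A (if h : (s : Γ) ∈ F then σ ⟨s, h⟩ else 0) at h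
      rw [e] at h
      refine (h l).le.trans_eq ?_
      rw [coe_smul_probabilityMeasure]
      exact integral_map (measurable_const_smul _).aemeasurable
        (φ (σ s) l).continuous.aestronglyMeasurable)
  refine ⟨Subtype.val '' H, hH.image Subtype.val_injective.injOn, fun J _ hJH σ => ?_⟩
  let J' : Finset F := J.subtype (· ∈ F)
  have hJ' : (J' : Set F) ⊆ H := fun s hs => by
    obtain ⟨t, ht, hts⟩ := hJH (Finset.mem_subtype.1 hs)
    rwa [← Subtype.ext hts]
  let τ : F → Fin k := fun s => if h : (s : Γ) ∈ J then σ ⟨s, h⟩ else 0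
  have hy : ∀ i : ∀ j, S j, ∃ y : X, 0 < w i →
      ∀ s ∈ J', 0 < φ (τ s) (i (τ s)) ((s : Γ) • y) := fun i => by
    by_cases hi : 0 < w i
    · obtain ⟨y, hy⟩ := hHφ i hi J' hJ' τ
      exact ⟨y, fun _ => hy⟩
    -- An atom of weight zero may sit anywhere, here at a point of `S 0`.
    · exact ⟨i 0, fun h => absurd h hi⟩
  choose y hy using hy
  obtain ⟨ν, hνcard, hνB⟩ := exists_probabilityMeasure_of_weights w hw0 hw1 y
  have hνN : ν ∈ finSuppMeasures X (∏ j, N j) := by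
    refine hνcard.trans ?_
    rw [Fintype.card_pi]
    simp only [Fintype.card_coe]
    exact_mod_cast Finset.prod_le_prod' fun j _ => hScard j
  refine ⟨⟨ν, hνN⟩, Set.mem_iInter.2 fun s => ?_⟩
  have hsF : (s : Γ) ∈ F := by
    obtain ⟨t, -, hts⟩ := hJH s.2
    rw [← hts]
    exact t.2
  refine hWU (σ s) _ (hVW (σ s) _ fun x hx => ?_)
  have hB : MeasurableSet ((fun y : X => (s : Γ) • y) ⁻¹' V (σ s) x) :=
    measurable_const_smul _ (hV (σ s) x).1.measurableSet
  have h3 := hνB _ (Finset.univ.filter fun i : ∀ j, S j => i (σ s) = ⟨x, hx⟩) hB fun i hi hwi => by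
    have h := hy i hwi ⟨s, hsF⟩ (Finset.mem_subtype.2 s.2)
    have e : τ ⟨s, hsF⟩ = σ s := by simp [τ]
    rw [e, (Finset.mem_filter.1 hi).2] at h
    exact hφV _ _ _ h
  have h4 := hwc (σ s) ⟨x, hx⟩
  have h5 : ∑ j, (1 - ∑ l, c j l) = ∑ j, ((S j).card : ℝ) * ε := by
    refine Finset.sum_congr rfl fun j _ => ?_
    simp only [c, Finset.sum_sub_distrib, hSsum]
    simp
  have h7 : (((s : Γ) • ν : ProbabilityMeasure X) : Measure X).real (V (σ s) x) =
      (ν : Measure X).real ((fun y : X => (s : Γ) • y) ⁻¹' V (σ s) x) := by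
    rw [coe_smul_probabilityMeasure, measureReal_def, measureReal_def,
      Measure.map_apply (measurable_const_smul _) (hV (σ s) x).1.measurableSet]
  change _ ≤ (((s : Γ) • ν : ProbabilityMeasure X) : Measure X).real (V (σ s) x)
  rw [h7]
  have h8 := hδle (σ s)
  simp only [c] at h4
  have h9 : ∑ j, (1 - ∑ l : S j, ((μ j : Measure X).real {(l : X)} - ε)) =
      ∑ j, ((S j).card : ℝ) * ε := h5
  linarith
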